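/- Let $\alpha\in(1/2,2)\setminus\{1\}$ and $p\in(\alpha,2\alpha)\cap[1,2]$, and let $E=\ell^p(\mathbb Z)$ be the complex sequence space with canonical basis $(e_n)_{n\in\mathbb Z}$, continuous dual $E^*$ and bilinear duality bracket $\langle z,x^*\rangle=x^*(z)$. Let $(\omega_n)_{n\in\mathbb Z}$ be positive weights and $k_0\ge 0$ a constant such that the sequence $$k_n:=k_0\prod_{l=n+1}^{0}\frac1{\omega_l}\quad(n\le -1),\qquad k_n:=k_0\prod_{l=1}^{n}\omega_l\quad(n\ge 0),$$ belongs to $\ell^\alpha(\mathbb Z)$. Let $\mu$ be the $\alpha$-stable probability measure on the Borel sets of $E$ with characteristic functional $$\int_E e^{i\,\mathrm{Re}\langle z,x^*\rangle}\,\mu(dz)=\exp\Big(-\int_E|\mathrm{Re}\langle z,x^*\rangle|^\alpha\,\xi(dz)\Big),\quad x^*\in E^*,\qquad \xi:=\frac12\sum_{n\in\mathbb Z}k_n^\alpha\,(\delta_{e_n}+\delta_{ie_n}).$$ Let $T$ be the weighted forward shift $Te_n=\omega_{n+1}e_{n+1}$, $n\in\mathbb Z$, assumed to be a bounded linear operator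 on $E$, and let $T^*:E^*\to E^*$ be its adjoint, $\langle z,T^*x^*\rangle=\langle Tz,x^*\rangle$. Suppose that there are integers $q_-\ge0$ and $q_+\ge1$ with $$\eta_-:=\sup_{l\le -q_-}\frac1{\omega_l}<1,\qquad \eta_+:=\sup_{l\ge q_+}\omega_l<1,\qquad \eta_+^{p/2}\ne\eta_-^{\alpha-p/2}.$$ Let $\phi,\psi\in\{\mathrm{Re},-\mathrm{Re},\mathrm{Im},-\mathrm{Im}\}$ with $\phi\neq\psi$, and let $(a_j)_{j\ge0}$, $(b_l)_{l\ge0}$ be complex sequences in $\ell^1(\mathbb N)$ such that $$\sum_{j=0}^\infty|a_j|\,\|T\|^{jp/2}<\infty\quad\text{and}\quad\sum_{l=0}^\infty|b_l|\,\|T\|^{lp/2}<\infty.$$ Then, for all $x^*,y^*\in E^*$, the series $$f(z):=\sum_{j=0}^\infty a_je^{i\phi(\langle z,T^{*j}x^*\rangle)},\qquad g(z):=\sum_{l=0}^\infty b_le^{i\psi(\langle z,T^{*l}y^*\rangle)}$$ converge absolutely for every $z\in E$, the functions $f$ and $g$ belong to $L^2(E,\mu)$, the function $z\mapsto f(z)g(T^nz)$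 is $\mu$-integrable for every $n\ge0$, and $$I_n(f,g):=\int_E f(z)\,g(T^nz)\,\mu(dz)-\int_E f\,d\mu\int_E g\,d\mu$$ satisfies, for some constant $C>0$ that does not depend on $n$, $$|I_n(f,g)|\le C\,\max\big(\eta_-^{2\alpha/p-1},\,\eta_+\big)^{\alpha n/2},\qquad n\ge0.$$ -/

import Mathlib

open MeasureTheory

noncomputable section

namespace StableShift

/-- The complex Banach space `ℓ^p(ℤ)`. -/
abbrev EllP (p : ℝ) : Type := lp (fun _ : ℤ => ℂ) (ENNReal.ofReal p)

/-- The canonical basis vector `e_n` of `ℓ^p(ℤ)`. -/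
def e (p : ℝ) (n : ℤ) : EllP p := lp.single (ENNReal.ofReal p) n (1 : ℂ)

/-- `k_n = k₀ ∏_{l=n+1}^0 1/ω_l` for `n ≤ -1` and `k_n = k₀ ∏_{l=1}^n ω_l` for `n ≥ 0`. -/
def kSeq (k₀ : ℝ) (ω : ℤ → ℝ) (n : ℤ) : ℝ :=
  if n ≤ -1 then k₀ * ∏ l ∈ Finset.Icc (n + 1) 0, 1 / ω l
  else k₀ * ∏ l ∈ Finset.Icc 1 n, ω l

/-- The control measure `ξ = (1/2) ∑_{n ∈ ℤ} k_n^α (δ_{e_n} + δ_{i e_n})`. -/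
def controlMeasure (p α k₀ : ℝ) (ω : ℤ → ℝ) [Fact (1 ≤ ENNReal.ofReal p)]
    [MeasurableSpace (EllP p)] : Measure (EllP p) :=
  Measure.sum fun n : ℤ =>
    ENNReal.ofReal (1 / 2 * kSeq k₀ ω n ^ α) •
      (Measure.dirac (e p n) + Measure.dirac (Complex.I • e p n))

section Banach

variable {E : Type*} [NormedAddCommGroup E] [NormedSpace ℂ E]

/-- `μ` is the (symmetric) `α`-stable probability measure with control measure `ξ`: its
characteristic functional is `exp (-∫ |Re ⟨z, x*⟩|^α ξ(dz))`. -/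
structure IsStableWithControl [MeasurableSpace E] (α : ℝ) (ξ μ : Measure E) : Prop where
  isProbabilityMeasure : IsProbabilityMeasure μ
  charFunctional : ∀ x : E →L[ℂ] ℂ,
    ∫ z, Complex.exp (Complex.I * ((x z).re : ℂ)) ∂μ
      = Complex.exp (-((∫ z, |(x z).re| ^ α ∂ξ : ℝ) : ℂ))

/-- The adjoint `T* : E* → E*`, `⟨z, T* x*⟩ = ⟨T z, x*⟩`. -/
def adj (T : E →L[ℂ] E) (x : E →L[ℂ] ℂ) : E →L[ℂ] ℂ := x.comp T

/-- The term `a_j e^{i φ(⟨z, T^{*j} x*⟩)}`. -/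
def expTerm (φ : ℂ → ℝ) (T : E →L[ℂ] E) (a : ℕ → ℂ) (x : E →L[ℂ] ℂ) (z : E) (j : ℕ) : ℂ :=
  a j * Complex.exp (Complex.I * (φ (((adj T)^[j] x) z) : ℂ))

/-- The function `z ↦ ∑_{j ≥ 0} a_j e^{i φ(⟨z, T^{*j} x*⟩)}`. -/
def expSeries (φ : ℂ → ℝ) (T : E →L[ℂ] E) (a : ℕ → ℂ) (x : E →L[ℂ] ℂ) (z : E) : ℂ :=
  ∑' j : ℕ, expTerm φ T a x z j

/-- `I_n(f, g) = ∫ f(z) g(T^n z) μ(dz) - ∫ f dμ ∫ g dμ`. -/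
def corr [MeasurableSpace E] (μ : Measure E) (T : E →L[ℂ] E) (f g : E → ℂ) (n : ℕ) : ℂ :=
  (∫ z, f z * g ((T ^ n) z) ∂μ) - (∫ z, f z ∂μ) * ∫ z, g z ∂μ

end Banach

/-- `T` is the weighted forward shift `T e_n = ω_{n+1} e_{n+1}` on `ℓ^p(ℤ)`. A bounded operator is
determined by these values, as the `e_n` span a dense subspace. -/
def IsWeightedForwardShift {p : ℝ} [Fact (1 ≤ ENNReal.ofReal p)] (ω : ℤ → ℝ)
    (T : EllP p →L[ℂ] EllP p) : Prop :=
  ∀ n : ℤ, T (e p n) = (ω (n + 1) : ℂ) • e p (n + 1)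

/-- The four functions `Re`, `-Re`, `Im`, `-Im`. -/
def partFunctions : Set (ℂ → ℝ) :=
  {fun w => w.re, fun w => -w.re, fun w => w.im, fun w => -w.im}

end StableShift

end

/-
Writing `w_m = k_m ⟨e_m, u⟩` for a functional `u`, the recursion `k_{m+1} = ω_{m+1} k_m` turns `T*`
into the translation `w ↦ w_{· + 1}`, while the exponent `Ψ(u) = ∫ |Re ⟨z, u⟩| ^ α ξ(dz)` becomes
`∑ (|Re w_m| ^ α + |Im w_m| ^ α) / 2`. Hence `Ψ ∘ T* = Ψ`, and the covariance of `e^{i Re u}` and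
`e^{i Re v}` is at most `|Ψ(u + v) - Ψ(u) - Ψ(v)|`. Since `|s| ^ (α / 2)` is subadditive, the last
quantity is bounded by `2 ∑ |w_m(u)| ^ (α / 2) |w_m(v)| ^ (α / 2)`. For `u = T*^j x` and
`v = T*^l y` this is a correlation at lag `l - j` of the sequence `k ^ (α / 2)`, which decays
geometrically at both ends. Summing over `j` and `l` against `a_j b_l` gives the rate.
-/

namespace StableShift

open Filter

section Elementary

theorem abs_exp_sub_exp_le_of_nonpos {s t : ℝ} (hs : s ≤ 0) (ht : t ≤ 0) :
    |Real.exp s - Real.exp t| ≤ |s - t| := by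
  have h := (convex_Iic (0 : ℝ)).norm_image_sub_le_of_norm_deriv_le (C := 1)
    (fun u _ => Real.differentiableAt_exp (x := u))
    (fun u hu => by simpa [Real.abs_exp] using hu) ht hs
  simpa using h

theorem abs_sq_sub_sq_sub_sq_le {a b c : ℝ} (ha : a ≤ b + c) (hb : b ≤ a + c) (hc : c ≤ a + b) :
    |a ^ 2 - b ^ 2 - c ^ 2| ≤ 2 * (b * c) := by
  have hlower : (b - c) ^ 2 ≤ a ^ 2 := sq_le_sq' (by linarith) (by linarith)
  have hupper : a ^ 2 ≤ (b + c) ^ 2 := pow_le_pow_left₀ (by linarith) ha 2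
  exact abs_le.2 ⟨by linarith, by linarith⟩

theorem abs_add_rpow_le {γ : ℝ} (hγ : 0 ≤ γ) (hγ1 : γ ≤ 1) (s t : ℝ) :
    |s + t| ^ γ ≤ |s| ^ γ + |t| ^ γ :=
  (Real.rpow_le_rpow (abs_nonneg _) (abs_add_le s t) hγ).trans
    (Real.rpow_add_le_add_rpow (abs_nonneg _) (abs_nonneg _) hγ hγ1)

theorem abs_abs_add_rpow_sub_sub_le {α : ℝ} (hα : 0 ≤ α) (hα2 : α ≤ 2) (s t : ℝ) :
    |(|s + t| ^ α - |s| ^ α - |t| ^ α)| ≤ 2 * (|s| ^ (α / 2) * |t| ^ (α / 2)) := by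
  have hsq (w : ℝ) : |w| ^ α = (|w| ^ (α / 2)) ^ 2 := by
    rw [← Real.rpow_mul_natCast (abs_nonneg w)]
    norm_num
  have hsub := abs_add_rpow_le (γ := α / 2) (by linarith) (by linarith)
  simp only [hsq]
  refine abs_sq_sub_sq_sub_sq_le (hsub s t) ?_ ?_
  · simpa using hsub (s + t) (-t)
  · simpa using hsub (s + t) (-s)

theorem exists_le_mul_pow_of_eventually_succ_le {f : ℕ → ℝ} {c : ℝ} (hc : 0 < c)
    (h : ∀ᶠ n in atTop, f (n + 1) ≤ c * f n) : ∃ C, ∀ n, f n ≤ C * c ^ n := by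
  obtain ⟨N, hN⟩ := eventually_atTop.1 h
  have hbound : ∀ n ≥ N, f n / c ^ n ≤ f N / c ^ N := fun n hn => by
    induction n, hn using Nat.le_induction with
    | base => exact le_rfl
    | succ m hm ih =>
      refine le_trans ?_ ih
      rw [div_le_div_iff₀ (by positivity) (by positivity), pow_succ]
      calc f (m + 1) * c ^ m ≤ c * f m * c ^ m := by gcongr; exact hN m hm
        _ = f m * (c ^ m * c) := by ring
  obtain ⟨C, hC⟩ := IsBoundedUnder.bddAbove_range
    (isBoundedUnder_of_eventually_le (eventually_atTop.2 ⟨N, hbound⟩))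
  exact ⟨C, fun n => (div_le_iff₀ (by positivity)).1 (hC ⟨n, rfl⟩)⟩

variable {K : ℤ → ℝ} {C β ρ : ℝ}

theorem le_mul_zpow_of_le_mul_pow (hβ0 : 0 ≤ β) (hβ1 : β ≤ 1) (hρ0 : 0 < ρ) (hρ1 : ρ ≤ 1)
    (hC : 0 ≤ C) (hright : ∀ n : ℕ, K n ≤ C * ρ ^ n) (hleft : ∀ n : ℕ, K (-n) ≤ C * β ^ n)
    (i : ℤ) : K i ≤ C * ρ ^ i := by
  obtain ⟨n, rfl | rfl⟩ := i.eq_nat_or_neg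
  · simpa using hright n
  · calc K (-n) ≤ C * β ^ n := hleft n
      _ ≤ C * 1 := by gcongr; exact pow_le_one₀ hβ0 hβ1
      _ ≤ C * ρ ^ (-n : ℤ) := by
        gcongr
        simpa using (one_le_inv₀ (by positivity)).2 (pow_le_one₀ hρ0.le hρ1)

theorem summable_zpow_mul_of_le_mul_pow (hK : ∀ i, 0 ≤ K i) (hβ : 0 ≤ β) (hβρ : β < ρ)
    (hρ : ρ < 1) (hright : ∀ n : ℕ, K n ≤ C * ρ ^ n) (hleft : ∀ n : ℕ, K (-n) ≤ C * β ^ n) :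
    Summable fun i : ℤ => ρ ^ i * K i := by
  have hρ0 : 0 < ρ := hβ.trans_lt hβρ
  have hnonneg (i : ℤ) : 0 ≤ ρ ^ i * K i := mul_nonneg (by positivity) (hK i)
  refine Summable.of_nat_of_neg ?_ ?_
  · refine .of_nonneg_of_le (fun n => hnonneg n) (fun n => ?_)
      ((summable_geometric_of_lt_one (by positivity) (show ρ * ρ < 1 by nlinarith)).mul_left C)
    calc ρ ^ (n : ℤ) * K n ≤ ρ ^ n * (C * ρ ^ n) := by
          rw [zpow_natCast]; gcongr; exact hright n
      _ = C * (ρ * ρ) ^ n := by ring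
  · refine .of_nonneg_of_le (fun n => hnonneg (-n)) (fun n => ?_)
      ((summable_geometric_of_lt_one (by positivity) ((div_lt_one hρ0).2 hβρ)).mul_left C)
    calc ρ ^ (-n : ℤ) * K (-n) ≤ (ρ ^ n)⁻¹ * (C * β ^ n) := by
          rw [zpow_neg, zpow_natCast]; gcongr; exact hleft n
      _ = C * (β / ρ) ^ n := by rw [div_pow]; ring

end Elementary

section Weights

variable {k₀ : ℝ} {ω : ℤ → ℝ}

theorem kSeq_nonneg (hk₀ : 0 ≤ k₀) (hω : ∀ n, 0 < ω n) (n : ℤ) : 0 ≤ kSeq k₀ ω n := by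
  unfold kSeq
  split_ifs
  · exact mul_nonneg hk₀ (Finset.prod_nonneg fun l _ => (one_div_pos.2 (hω l)).le)
  · exact mul_nonneg hk₀ (Finset.prod_nonneg fun l _ => (hω l).le)

theorem kSeq_add_one (hω : ∀ n, ω n ≠ 0) (n : ℤ) :
    kSeq k₀ ω (n + 1) = ω (n + 1) * kSeq k₀ ω n := by
  have h0 := hω (n + 1)
  unfold kSeq
  rcases lt_trichotomy n (-1) with h | rfl | h
  · rw [if_pos (by omega), if_pos (by omega),
      ← Finset.insert_Icc_add_one_left_eq_Icc (show n + 1 ≤ 0 by omega),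
      Finset.prod_insert (by simp)]
    field_simp
  · norm_num at h0 ⊢
    field_simp
  · rw [if_neg (by omega), if_neg (by omega), ← Finset.insert_Icc_right_eq_Icc_add_one (by omega),
      Finset.prod_insert (by simp)]
    ring

theorem kSeq_add_one_rpow (hk₀ : 0 ≤ k₀) (hω : ∀ n, 0 < ω n) (γ : ℝ) (n : ℤ) :
    kSeq k₀ ω (n + 1) ^ γ = ω (n + 1) ^ γ * kSeq k₀ ω n ^ γ := by
  rw [kSeq_add_one fun n => (hω n).ne', Real.mul_rpow (hω _).le (kSeq_nonneg hk₀ hω _)]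

theorem exists_kSeq_rpow_le_right (hk₀ : 0 ≤ k₀) (hω : ∀ n, 0 < ω n) {r γ : ℝ} (hr : 0 < r)
    (hγ : 0 ≤ γ) (h : ∀ᶠ l in atTop, ω l ≤ r) :
    ∃ C, ∀ n : ℕ, kSeq k₀ ω n ^ γ ≤ C * (r ^ γ) ^ n := by
  refine exists_le_mul_pow_of_eventually_succ_le (by positivity) ?_
  filter_upwards [((tendsto_natCast_atTop_atTop (R := ℤ)).comp
    (tendsto_add_atTop_nat 1)).eventually h] with n hn
  have := Real.rpow_nonneg (kSeq_nonneg hk₀ hω n) γ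
  have := (hω (n + 1)).le
  push_cast [Function.comp_apply] at hn ⊢
  rw [kSeq_add_one_rpow hk₀ hω]
  gcongr

theorem exists_kSeq_rpow_le_left (hk₀ : 0 ≤ k₀) (hω : ∀ n, 0 < ω n) {β γ : ℝ} (hβ : 0 < β)
    (hγ : 0 ≤ γ) (h : ∀ᶠ l in atBot, 1 / ω l ≤ β) :
    ∃ C, ∀ n : ℕ, kSeq k₀ ω (-n) ^ γ ≤ C * (β ^ γ) ^ n := by
  refine exists_le_mul_pow_of_eventually_succ_le (f := fun n => kSeq k₀ ω (-n) ^ γ)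
    (by positivity) ?_
  filter_upwards [(tendsto_neg_atTop_atBot.comp
    (tendsto_natCast_atTop_atTop (R := ℤ))).eventually h] with n hn
  have hone : 1 ≤ (β * ω (-n)) ^ γ := Real.one_le_rpow ((div_le_iff₀ (hω _)).1 hn) hγ
  have hstep := kSeq_add_one_rpow hk₀ hω γ (-(n + 1))
  rw [neg_add_rev, neg_add_cancel_comm] at hstep
  push_cast
  rw [neg_add_rev, hstep, ← mul_assoc, ← Real.mul_rpow hβ.le (hω _).le]
  exact le_mul_of_one_le_left (Real.rpow_nonneg (kSeq_nonneg hk₀ hω _) γ) hone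

theorem exists_kSeq_rpow_le_and_summable (hk₀ : 0 ≤ k₀) (hω : ∀ n, 0 < ω n) {β r γ : ℝ}
    (hγ : 0 < γ) (hβr : β < r) (hr : r < 1) (hleft : ∀ᶠ l in atBot, 1 / ω l ≤ β)
    (hright : ∀ᶠ l in atTop, ω l ≤ r) :
    ∃ C, (∀ i, kSeq k₀ ω i ^ γ ≤ C * (r ^ γ) ^ i) ∧
      Summable fun i : ℤ => (r ^ γ) ^ i * kSeq k₀ ω i ^ γ := by
  have hβ : 0 < β := by
    obtain ⟨l, hl⟩ := hleft.exists
    exact (one_div_pos.2 (hω l)).trans_le hl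
  have hr0 : 0 < r := hβ.trans hβr
  have hK (i : ℤ) : 0 ≤ kSeq k₀ ω i ^ γ := Real.rpow_nonneg (kSeq_nonneg hk₀ hω i) γ
  obtain ⟨Cr, hCr⟩ := exists_kSeq_rpow_le_right hk₀ hω hr0 hγ.le hright
  obtain ⟨Cl, hCl⟩ := exists_kSeq_rpow_le_left hk₀ hω hβ hγ.le hleft
  have hCr' (n : ℕ) : kSeq k₀ ω n ^ γ ≤ max Cr Cl * (r ^ γ) ^ n :=
    (hCr n).trans (by gcongr; exact le_max_left _ _)
  have hCl' (n : ℕ) : kSeq k₀ ω (-n) ^ γ ≤ max Cr Cl * (β ^ γ) ^ n :=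
    (hCl n).trans (by gcongr; exact le_max_right _ _)
  have hC : 0 ≤ max Cr Cl := (hK 0).trans (by simpa using hCr' 0)
  have hργ : r ^ γ < 1 := Real.rpow_lt_one hr0.le hr hγ
  have hβγ : β ^ γ < r ^ γ := Real.rpow_lt_rpow hβ.le hβr hγ
  exact ⟨max Cr Cl, le_mul_zpow_of_le_mul_pow (by positivity) (hβγ.trans hργ).le (by positivity)
      hργ.le hC hCr' hCl',
    summable_zpow_mul_of_le_mul_pow hK (by positivity) hβγ hργ hCr' hCl'⟩

theorem summable_kSeq_rpow (hk₀ : 0 ≤ k₀) (hω : ∀ n, 0 < ω n) {β r α : ℝ} (hα : 0 < α)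
    (hβr : β < r) (hr : r < 1) (hleft : ∀ᶠ l in atBot, 1 / ω l ≤ β)
    (hright : ∀ᶠ l in atTop, ω l ≤ r) : Summable fun n : ℤ => kSeq k₀ ω n ^ α := by
  obtain ⟨C, hle, hsum⟩ :=
    exists_kSeq_rpow_le_and_summable hk₀ hω (half_pos hα) hβr hr hleft hright
  have hk (n : ℤ) : 0 ≤ kSeq k₀ ω n := kSeq_nonneg hk₀ hω n
  refine .of_nonneg_of_le (fun n => Real.rpow_nonneg (hk n) α) (fun n => ?_) (hsum.mul_left C)
  have hhalf := Real.rpow_nonneg (hk n) (α / 2)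
  calc kSeq k₀ ω n ^ α = kSeq k₀ ω n ^ (α / 2) * kSeq k₀ ω n ^ (α / 2) := by
        rw [← Real.rpow_add_of_nonneg (hk n) (half_pos hα).le (half_pos hα).le, add_halves]
    _ ≤ C * (r ^ (α / 2)) ^ n * kSeq k₀ ω n ^ (α / 2) := by gcongr; exact hle n
    _ = C * ((r ^ (α / 2)) ^ n * kSeq k₀ ω n ^ (α / 2)) := mul_assoc _ _ _

end Weights

section Sums

theorem hasSum_integral_of_norm_le {Ω ι G : Type*} [MeasurableSpace Ω] [Countable ι]
    [NormedAddCommGroup G] [NormedSpace ℝ G] {ν : Measure Ω} [IsFiniteMeasure ν] {F : ι → Ω → G}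
    {c : ι → ℝ} (hF : ∀ i, AEStronglyMeasurable (F i) ν) (hc : Summable c)
    (hle : ∀ i z, ‖F i z‖ ≤ c i) :
    HasSum (fun i => ∫ z, F i z ∂ν) (∫ z, ∑' i, F i z ∂ν) := by
  have hint (i : ι) : Integrable (F i) ν := .of_bound (hF i) (c i) (ae_of_all _ (hle i))
  refine hasSum_integral_of_summable_integral_norm hint
    (.of_nonneg_of_le (fun i => integral_nonneg fun z => norm_nonneg _) (fun i => ?_)
      (hc.mul_left (ν.real Set.univ)))
  calc ∫ z, ‖F i z‖ ∂ν ≤ ∫ _, c i ∂ν := integral_mono (hint i).norm (integrable_const _) (hle i)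
    _ = ν.real Set.univ * c i := by rw [integral_const, smul_eq_mul]

theorem norm_sub_mul_le_of_hasSum {ι κ R : Type*} [NormedRing R] [CompleteSpace R]
    {F : ι → R} {G : κ → R} {H : ι × κ → R} {u v w : R} (hF : HasSum F u) (hG : HasSum G v)
    (hH : HasSum H w) (hFn : Summable fun j => ‖F j‖) (hGn : Summable fun l => ‖G l‖)
    {A : ι → ℝ} {B : κ → ℝ} (hA : Summable A) (hB : Summable B) (hA0 : ∀ j, 0 ≤ A j)
    (hB0 : ∀ l, 0 ≤ B l) (hle : ∀ j l, ‖H (j, l) - F j * G l‖ ≤ A j * B l) :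
    ‖w - u * v‖ ≤ (∑' j, A j) * ∑' l, B l := by
  have hAB : Summable fun i : ι × κ => A i.1 * B i.2 := hA.mul_of_nonneg hB hA0 hB0
  have hFG : HasSum (fun i : ι × κ => F i.1 * G i.2) (u * v) :=
    hF.mul hG (summable_mul_of_summable_norm hFn hGn)
  rw [hA.tsum_mul_tsum hB hAB, ← (hH.sub hFG).tsum_eq]
  exact tsum_of_norm_bounded hAB.hasSum fun i => hle i.1 i.2

end Sums

section Stable

variable {E : Type*} [NormedAddCommGroup E] [NormedSpace ℂ E]

theorem adj_iterate_apply (T : E →L[ℂ] E) (x : E →L[ℂ] ℂ) (j : ℕ) (z : E) :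
    ((adj T)^[j] x) z = x ((T ^ j) z) := by
  induction j generalizing z with
  | zero => simp
  | succ j ih => simp only [Function.iterate_succ_apply', adj, ContinuousLinearMap.comp_apply, ih,
      pow_succ, mul_apply_eq_comp]

theorem expTerm_apply_pow (φ : ℂ → ℝ) (T : E →L[ℂ] E) (b : ℕ → ℂ) (y : E →L[ℂ] ℂ) (z : E)
    (l n : ℕ) : expTerm φ T b y ((T ^ n) z) l =
      b l * Complex.exp (Complex.I * (φ (((adj T)^[l + n] y) z) : ℂ)) := by
  rw [expTerm, adj_iterate_apply, adj_iterate_apply, pow_add, mul_apply_eq_comp]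

theorem expSeries_linearMap (φ : ℂ →ₗ[ℝ] ℝ) (T : E →L[ℂ] E) (a : ℕ → ℂ) (x : E →L[ℂ] ℂ) :
    expSeries φ T a x =
      expSeries Complex.re T a ((φ 1 - φ Complex.I * Complex.I : ℂ) • x) := by
  have hφ (w : ℂ) : φ w = ((φ 1 - φ Complex.I * Complex.I : ℂ) * w).re := by
    have hw : w = w.re • 1 + w.im • Complex.I := by simp
    conv_lhs => rw [hw, map_add, map_smul, map_smul]
    simp [mul_comm]
  funext z
  simp only [expSeries, expTerm, adj_iterate_apply, hφ (x _), smul_apply, smul_eq_mul]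

theorem norm_expTerm (φ : ℂ → ℝ) (T : E →L[ℂ] E) (a : ℕ → ℂ) (x : E →L[ℂ] ℂ) (z : E) (j : ℕ) :
    ‖expTerm φ T a x z j‖ = ‖a j‖ := by
  rw [expTerm, norm_mul, mul_comm Complex.I, Complex.norm_exp_ofReal_mul_I, mul_one]

theorem summable_norm_expTerm (φ : ℂ → ℝ) (T : E →L[ℂ] E) {a : ℕ → ℂ}
    (ha : Summable fun j => ‖a j‖) (x : E →L[ℂ] ℂ) (z : E) :
    Summable fun j => ‖expTerm φ T a x z j‖ := by
  simpa only [norm_expTerm] using ha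

theorem continuous_expTerm {φ : ℂ → ℝ} (hφ : Continuous φ) (T : E →L[ℂ] E) (a : ℕ → ℂ)
    (x : E →L[ℂ] ℂ) (j : ℕ) : Continuous fun z => expTerm φ T a x z j := by
  unfold expTerm
  fun_prop

theorem continuous_expSeries {φ : ℂ → ℝ} (hφ : Continuous φ) (T : E →L[ℂ] E) {a : ℕ → ℂ}
    (ha : Summable fun j => ‖a j‖) (x : E →L[ℂ] ℂ) : Continuous (expSeries φ T a x) :=
  continuous_tsum (continuous_expTerm hφ T a x) ha fun j z => (norm_expTerm φ T a x z j).le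

theorem norm_expSeries_le (φ : ℂ → ℝ) (T : E →L[ℂ] E) {a : ℕ → ℂ}
    (ha : Summable fun j => ‖a j‖) (x : E →L[ℂ] ℂ) (z : E) :
    ‖expSeries φ T a x z‖ ≤ ∑' j, ‖a j‖ :=
  tsum_of_norm_bounded ha.hasSum fun j => (norm_expTerm φ T a x z j).le

variable [MeasurableSpace E]

/-- The exponent `∫ |Re ⟨z, u⟩| ^ α ξ(dz)` in the characteristic functional of the `α`-stable
measure with control measure `ξ`. -/
noncomputable def charExponent (α : ℝ) (ξ : Measure E) (u : E →L[ℂ] ℂ) : ℝ :=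
  ∫ z, |(u z).re| ^ α ∂ξ

/-- The codifference of the real stable variables `Re ⟨z, u⟩` and `Re ⟨z, v⟩`, which vanishes
when they are independent. Its sign is chosen so that the covariance of `e^{i Re ⟨z, u⟩}` and
`e^{i Re ⟨z, v⟩}` involves the sum `u + v` rather than a difference. -/
noncomputable def codifference (α : ℝ) (ξ : Measure E) (u v : E →L[ℂ] ℂ) : ℝ :=
  charExponent α ξ (u + v) - charExponent α ξ u - charExponent α ξ v

theorem charExponent_nonneg (α : ℝ) (ξ : Measure E) (u : E →L[ℂ] ℂ) : 0 ≤ charExponent α ξ u :=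
  integral_nonneg fun _ => by positivity

theorem charExponent_adj_iterate {α : ℝ} {ξ : Measure E} {T : E →L[ℂ] E}
    (hinv : ∀ u, charExponent α ξ (adj T u) = charExponent α ξ u) (u : E →L[ℂ] ℂ) (j : ℕ) :
    charExponent α ξ ((adj T)^[j] u) = charExponent α ξ u := by
  induction j with
  | zero => rfl
  | succ j ih => rw [Function.iterate_succ_apply', hinv, ih]

variable {α : ℝ} {ξ μ : Measure E}

theorem IsStableWithControl.integral_exp_re (hμ : IsStableWithControl α ξ μ) (u : E →L[ℂ] ℂ) :
    ∫ z, Complex.exp (Complex.I * ((u z).re : ℂ)) ∂μ = (Real.exp (-charExponent α ξ u) : ℝ) := by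
  rw [hμ.charFunctional, charExponent, Complex.ofReal_exp, Complex.ofReal_neg]

theorem IsStableWithControl.norm_integral_exp_mul_exp_sub_le (hμ : IsStableWithControl α ξ μ)
    (u v : E →L[ℂ] ℂ) :
    ‖(∫ z, Complex.exp (Complex.I * ((u z).re : ℂ)) * Complex.exp (Complex.I * ((v z).re : ℂ)) ∂μ)
      - (∫ z, Complex.exp (Complex.I * ((u z).re : ℂ)) ∂μ) *
        ∫ z, Complex.exp (Complex.I * ((v z).re : ℂ)) ∂μ‖ ≤ |codifference α ξ u v| := by
  have hmul (z : E) : Complex.exp (Complex.I * ((u z).re : ℂ)) *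
      Complex.exp (Complex.I * ((v z).re : ℂ)) =
        Complex.exp (Complex.I * (((u + v) z).re : ℂ)) := by
    rw [← Complex.exp_add, ← mul_add, add_apply, Complex.add_re, Complex.ofReal_add]
  have hnonneg := charExponent_nonneg α ξ
  simp only [hmul, hμ.integral_exp_re, ← Complex.ofReal_mul, ← Complex.ofReal_sub,
    ← Real.exp_add, Complex.norm_real, Real.norm_eq_abs]
  refine (abs_exp_sub_exp_le_of_nonpos (by linarith [hnonneg (u + v)])
    (by linarith [hnonneg u, hnonneg v])).trans_eq ?_
  rw [codifference, ← abs_neg]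
  ring_nf

theorem IsStableWithControl.norm_integral_expTerm_mul_sub_le (hμ : IsStableWithControl α ξ μ)
    {T : E →L[ℂ] E} (hinv : ∀ u, charExponent α ξ (adj T u) = charExponent α ξ u) (a b : ℕ → ℂ)
    (x y : E →L[ℂ] ℂ) (n j l : ℕ) :
    ‖(∫ z, expTerm Complex.re T a x z j * expTerm Complex.re T b y ((T ^ n) z) l ∂μ)
      - (∫ z, expTerm Complex.re T a x z j ∂μ) * ∫ z, expTerm Complex.re T b y z l ∂μ‖ ≤
    ‖a j‖ * ‖b l‖ * |codifference α ξ ((adj T)^[j] x) ((adj T)^[l + n] y)| := by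
  have hstat : ∫ z, Complex.exp (Complex.I * ((((adj T)^[l] y) z).re : ℂ)) ∂μ =
      ∫ z, Complex.exp (Complex.I * ((((adj T)^[l + n] y) z).re : ℂ)) ∂μ := by
    simp only [hμ.integral_exp_re, charExponent_adj_iterate hinv]
  simp only [expTerm_apply_pow]
  simp only [expTerm, mul_mul_mul_comm (a j), integral_const_mul, hstat]
  rw [← mul_sub, norm_mul, norm_mul]
  gcongr
  exact hμ.norm_integral_exp_mul_exp_sub_le _ _

theorem summable_norm_integral_expTerm {μ : Measure E} [IsFiniteMeasure μ] (φ : ℂ → ℝ)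
    (T : E →L[ℂ] E) {a : ℕ → ℂ} (ha : Summable fun j => ‖a j‖) (x : E →L[ℂ] ℂ) :
    Summable fun j => ‖∫ z, expTerm φ T a x z j ∂μ‖ :=
  .of_nonneg_of_le (fun _ => norm_nonneg _)
    (fun j => norm_integral_le_of_norm_le_const (ae_of_all _ fun z =>
      (norm_expTerm φ T a x z j).le)) (ha.mul_right (μ.real Set.univ))

variable [BorelSpace E]

section Finite

variable [IsFiniteMeasure μ] {φ ψ : ℂ → ℝ} {a b : ℕ → ℂ}

theorem memLp_expSeries (hφ : Continuous φ) (T : E →L[ℂ] E) (ha : Summable fun j => ‖a j‖)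
    (x : E →L[ℂ] ℂ) (q : ENNReal) : MemLp (expSeries φ T a x) q μ :=
  .of_bound (continuous_expSeries hφ T ha x).aestronglyMeasurable _
    (ae_of_all _ (norm_expSeries_le φ T ha x))

theorem integrable_expSeries_mul (hφ : Continuous φ) (hψ : Continuous ψ) (T : E →L[ℂ] E)
    (ha : Summable fun j => ‖a j‖) (hb : Summable fun l => ‖b l‖) (x y : E →L[ℂ] ℂ) (n : ℕ) :
    Integrable (fun z => expSeries φ T a x z * expSeries ψ T b y ((T ^ n) z)) μ :=
  (memLp_expSeries hφ T ha x 1).integrable le_rfl |>.mul_bdd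
    ((continuous_expSeries hψ T hb y).comp (T ^ n).continuous).aestronglyMeasurable
    (ae_of_all _ fun _ => norm_expSeries_le ψ T hb y _)

theorem hasSum_integral_expSeries (hφ : Continuous φ) (T : E →L[ℂ] E)
    (ha : Summable fun j => ‖a j‖) (x : E →L[ℂ] ℂ) :
    HasSum (fun j => ∫ z, expTerm φ T a x z j ∂μ) (∫ z, expSeries φ T a x z ∂μ) :=
  hasSum_integral_of_norm_le (fun j => (continuous_expTerm hφ T a x j).aestronglyMeasurable) ha
    fun j z => (norm_expTerm φ T a x z j).le

theorem hasSum_integral_expSeries_mul (hφ : Continuous φ) (hψ : Continuous ψ) (T : E →L[ℂ] E)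
    (ha : Summable fun j => ‖a j‖) (hb : Summable fun l => ‖b l‖) (x y : E →L[ℂ] ℂ) (n : ℕ) :
    HasSum (fun i : ℕ × ℕ => ∫ z, expTerm φ T a x z i.1 * expTerm ψ T b y ((T ^ n) z) i.2 ∂μ)
      (∫ z, expSeries φ T a x z * expSeries ψ T b y ((T ^ n) z) ∂μ) := by
  have hprod (z : E) : expSeries φ T a x z * expSeries ψ T b y ((T ^ n) z) =
      ∑' i : ℕ × ℕ, expTerm φ T a x z i.1 * expTerm ψ T b y ((T ^ n) z) i.2 :=
    tsum_mul_tsum_of_summable_norm (summable_norm_expTerm φ T ha x z)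
      (summable_norm_expTerm ψ T hb y _)
  simp only [hprod]
  refine hasSum_integral_of_norm_le (c := fun i => ‖a i.1‖ * ‖b i.2‖) (fun i => ?_)
    (ha.mul_of_nonneg hb (fun _ => norm_nonneg _) fun _ => norm_nonneg _) fun i z => ?_
  · exact ((continuous_expTerm hφ T a x i.1).mul
      ((continuous_expTerm hψ T b y i.2).comp (T ^ n).continuous)).aestronglyMeasurable
  · rw [norm_mul, norm_expTerm, norm_expTerm]

theorem norm_corr_expSeries_le (hφ : Continuous φ) (hψ : Continuous ψ) (T : E →L[ℂ] E)
    (ha : Summable fun j => ‖a j‖) (hb : Summable fun l => ‖b l‖) (x y : E →L[ℂ] ℂ) (n : ℕ)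
    {A B : ℕ → ℝ} (hA : Summable A) (hB : Summable B) (hA0 : ∀ j, 0 ≤ A j) (hB0 : ∀ l, 0 ≤ B l)
    (hle : ∀ j l, ‖(∫ z, expTerm φ T a x z j * expTerm ψ T b y ((T ^ n) z) l ∂μ)
      - (∫ z, expTerm φ T a x z j ∂μ) * ∫ z, expTerm ψ T b y z l ∂μ‖ ≤ A j * B l) :
    ‖corr μ T (expSeries φ T a x) (expSeries ψ T b y) n‖ ≤ (∑' j, A j) * ∑' l, B l :=
  norm_sub_mul_le_of_hasSum (hasSum_integral_expSeries hφ T ha x)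
    (hasSum_integral_expSeries hψ T hb y) (hasSum_integral_expSeries_mul hφ hψ T ha hb x y n)
    (summable_norm_integral_expTerm φ T ha x) (summable_norm_integral_expTerm ψ T hb y)
    hA hB hA0 hB0 hle

end Finite

theorem IsStableWithControl.norm_corr_expSeries_le (hμ : IsStableWithControl α ξ μ)
    {T : E →L[ℂ] E} (hinv : ∀ u, charExponent α ξ (adj T u) = charExponent α ξ u)
    {a b : ℕ → ℂ} {x y : E →L[ℂ] ℂ} {D ρ : ℝ} (hρ0 : 0 < ρ) (hρ1 : ρ ≤ 1)
    (hdecay : ∀ j l : ℕ,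
      |codifference α ξ ((adj T)^[j] x) ((adj T)^[l] y)| ≤ D * ρ ^ ((l : ℤ) - j))
    (ha : Summable fun j => ‖a j‖) (haρ : Summable fun j => ‖a j‖ * (ρ ^ j)⁻¹)
    (hb : Summable fun l => ‖b l‖) (n : ℕ) :
    ‖corr μ T (expSeries Complex.re T a x) (expSeries Complex.re T b y) n‖ ≤
      D * (∑' j, ‖a j‖ * (ρ ^ j)⁻¹) * (∑' l, ‖b l‖) * ρ ^ n := by
  have := hμ.isProbabilityMeasure
  have hD : 0 ≤ D := (abs_nonneg _).trans (by simpa using hdecay 0 0)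
  refine (StableShift.norm_corr_expSeries_le Complex.continuous_re Complex.continuous_re T ha hb x y
    n (haρ.mul_left (D * ρ ^ n)) hb (fun j => by positivity) (fun l => norm_nonneg _)
    fun j l => ?_).trans_eq ?_
  · have hpow : ρ ^ (((l + n : ℕ) : ℤ) - j) ≤ ρ ^ n * (ρ ^ j)⁻¹ := by
      rw [zpow_sub₀ hρ0.ne', zpow_natCast, zpow_natCast, div_eq_mul_inv]
      gcongr ?_ * _
      exact pow_le_pow_of_le_one hρ0.le hρ1 (Nat.le_add_left n l)
    calc _ ≤ ‖a j‖ * ‖b l‖ * |codifference α ξ ((adj T)^[j] x) ((adj T)^[l + n] y)| :=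
          hμ.norm_integral_expTerm_mul_sub_le hinv a b x y n j l
      _ ≤ ‖a j‖ * ‖b l‖ * (D * (ρ ^ n * (ρ ^ j)⁻¹)) := by
          gcongr
          exact (hdecay j (l + n)).trans (by gcongr)
      _ = D * ρ ^ n * (‖a j‖ * (ρ ^ j)⁻¹) * ‖b l‖ := by ring
  · rw [tsum_mul_left]
    ring

end Stable

section PartMean

/-- The mean of `|Re w| ^ α` and `|Im w| ^ α`, that is, of `|Re (c w)| ^ α` over `c ∈ {1, i}`: the
contribution to the exponent of a pair of atoms `e`, `i e` of the control measure. -/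
noncomputable def partMean (α : ℝ) (w : ℂ) : ℝ :=
  (|w.re| ^ α + |w.im| ^ α) / 2

variable {α : ℝ}

theorem partMean_nonneg (α : ℝ) (w : ℂ) : 0 ≤ partMean α w := by
  unfold partMean
  positivity

theorem partMean_le_norm_rpow (hα : 0 ≤ α) (w : ℂ) : partMean α w ≤ ‖w‖ ^ α := by
  have hre : |w.re| ^ α ≤ ‖w‖ ^ α := by gcongr; exact Complex.abs_re_le_norm w
  have him : |w.im| ^ α ≤ ‖w‖ ^ α := by gcongr; exact Complex.abs_im_le_norm w
  unfold partMean
  linarith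

theorem partMean_ofReal_mul {c : ℝ} (hc : 0 ≤ c) (w : ℂ) :
    partMean α (c * w) = c ^ α * partMean α w := by
  simp only [partMean, Complex.re_ofReal_mul, Complex.im_ofReal_mul, abs_mul, abs_of_nonneg hc,
    Real.mul_rpow hc (abs_nonneg _)]
  ring

theorem abs_partMean_add_sub_sub_le (hα : 0 ≤ α) (hα2 : α ≤ 2) (v w : ℂ) :
    |partMean α (v + w) - partMean α v - partMean α w| ≤
      2 * (‖v‖ ^ (α / 2) * ‖w‖ ^ (α / 2)) := by
  have hre : |v.re| ^ (α / 2) * |w.re| ^ (α / 2) ≤ ‖v‖ ^ (α / 2) * ‖w‖ ^ (α / 2) := by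
    gcongr <;> exact Complex.abs_re_le_norm _
  have him : |v.im| ^ (α / 2) * |w.im| ^ (α / 2) ≤ ‖v‖ ^ (α / 2) * ‖w‖ ^ (α / 2) := by
    gcongr <;> exact Complex.abs_im_le_norm _
  have hre' := abs_le.1 (abs_abs_add_rpow_sub_sub_le hα hα2 v.re w.re)
  have him' := abs_le.1 (abs_abs_add_rpow_sub_sub_le hα hα2 v.im w.im)
  simp only [partMean, Complex.add_re, Complex.add_im]
  exact abs_le.2 ⟨by linarith, by linarith⟩

end PartMean

section Shift

variable {p : ℝ} [Fact (1 ≤ ENNReal.ofReal p)] {α k₀ : ℝ} {ω : ℤ → ℝ}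

theorem norm_e (n : ℤ) : ‖e p n‖ = 1 := by
  rw [e, lp.norm_single (zero_lt_one.trans_le Fact.out), norm_one]

theorem norm_apply_e_le (u : EllP p →L[ℂ] ℂ) (n : ℤ) : ‖u (e p n)‖ ≤ ‖u‖ := by
  simpa [norm_e] using u.le_opNorm (e p n)

theorem IsWeightedForwardShift.abs_le_opNorm {T : EllP p →L[ℂ] EllP p}
    (hT : IsWeightedForwardShift ω T) (n : ℤ) : |ω n| ≤ ‖T‖ := by
  have h := T.le_opNorm (e p (n - 1))
  rwa [hT, norm_smul, norm_e, norm_e, mul_one, mul_one, sub_add_cancel, Complex.norm_real] at h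

theorem IsWeightedForwardShift.inv_le_opNorm {T : EllP p →L[ℂ] EllP p}
    (hT : IsWeightedForwardShift ω T) {r : ℝ} (hr : 0 < r) {n : ℤ} (hω : 0 < ω n)
    (hn : 1 / ω n ≤ r) : r⁻¹ ≤ ‖T‖ :=
  ((inv_le_comm₀ hω hr).1 (by simpa using hn)).trans ((le_abs_self _).trans (hT.abs_le_opNorm n))

/-- The coordinates `k_m ⟨e_m, u⟩` of a functional on `ℓ^p(ℤ)`, weighted so that the adjoint of the
weighted shift acts on them as a translation. -/
noncomputable def weightedCoord (k₀ : ℝ) (ω : ℤ → ℝ) (u : EllP p →L[ℂ] ℂ) (m : ℤ) : ℂ :=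
  kSeq k₀ ω m * u (e p m)

theorem weightedCoord_add (u v : EllP p →L[ℂ] ℂ) (m : ℤ) :
    weightedCoord k₀ ω (u + v) m = weightedCoord k₀ ω u m + weightedCoord k₀ ω v m := by
  simp only [weightedCoord, add_apply, mul_add]

theorem weightedCoord_adj (hω : ∀ n, ω n ≠ 0) {T : EllP p →L[ℂ] EllP p}
    (hT : IsWeightedForwardShift ω T) (u : EllP p →L[ℂ] ℂ) (m : ℤ) :
    weightedCoord k₀ ω (adj T u) m = weightedCoord k₀ ω u (m + 1) := by
  simp only [weightedCoord, adj, ContinuousLinearMap.comp_apply, hT m, map_smul, smul_eq_mul,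
    kSeq_add_one hω, Complex.ofReal_mul]
  ring

theorem weightedCoord_adj_iterate (hω : ∀ n, ω n ≠ 0) {T : EllP p →L[ℂ] EllP p}
    (hT : IsWeightedForwardShift ω T) (u : EllP p →L[ℂ] ℂ) (j : ℕ) (m : ℤ) :
    weightedCoord k₀ ω ((adj T)^[j] u) m = weightedCoord k₀ ω u (m + j) := by
  induction j generalizing m with
  | zero => simp
  | succ j ih =>
    rw [Function.iterate_succ_apply', weightedCoord_adj hω hT, ih, Nat.cast_succ, add_right_comm,
      add_assoc]

theorem norm_weightedCoord_rpow_le (hk₀ : 0 ≤ k₀) (hω : ∀ n, 0 < ω n) {γ : ℝ} (hγ : 0 ≤ γ)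
    (u : EllP p →L[ℂ] ℂ) (m : ℤ) :
    ‖weightedCoord k₀ ω u m‖ ^ γ ≤ kSeq k₀ ω m ^ γ * ‖u‖ ^ γ := by
  have hk := kSeq_nonneg hk₀ hω m
  rw [weightedCoord, norm_mul, Complex.norm_of_nonneg hk, Real.mul_rpow hk (norm_nonneg _)]
  gcongr
  exact norm_apply_e_le u m

theorem summable_partMean_weightedCoord (hα : 0 ≤ α) (hk₀ : 0 ≤ k₀) (hω : ∀ n, 0 < ω n)
    (hk : Summable fun n : ℤ => kSeq k₀ ω n ^ α) (u : EllP p →L[ℂ] ℂ) :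
    Summable fun m => partMean α (weightedCoord k₀ ω u m) :=
  .of_nonneg_of_le (fun _ => partMean_nonneg α _)
    (fun m => (partMean_le_norm_rpow hα _).trans (norm_weightedCoord_rpow_le hk₀ hω hα u m))
    (hk.mul_right (‖u‖ ^ α))

variable [MeasurableSpace (EllP p)] [BorelSpace (EllP p)]

theorem charExponent_controlMeasure (hα : 0 ≤ α) (hk₀ : 0 ≤ k₀) (hω : ∀ n, 0 < ω n)
    (hk : Summable fun n : ℤ => kSeq k₀ ω n ^ α) (u : EllP p →L[ℂ] ℂ) :
    charExponent α (controlMeasure p α k₀ ω) u =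
      ∑' m, partMean α (weightedCoord k₀ ω u m) := by
  set F : EllP p → ℝ := fun z => |(u z).re| ^ α
  have hF : StronglyMeasurable F :=
    ((Complex.continuous_re.comp u.continuous).abs.rpow_const fun _ => Or.inr hα).stronglyMeasurable
  have hdirac (z : EllP p) : Integrable F (Measure.dirac z) := integrable_dirac (by simp)
  have hatom (m : ℤ) : ∫ z, F z ∂(ENNReal.ofReal (1 / 2 * kSeq k₀ ω m ^ α) •
      (Measure.dirac (e p m) + Measure.dirac (Complex.I • e p m))) =
        partMean α (weightedCoord k₀ ω u m) := by
    have hkm := kSeq_nonneg hk₀ hω m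
    rw [integral_smul_measure, integral_add_measure (hdirac _) (hdirac _),
      integral_dirac' _ _ hF, integral_dirac' _ _ hF, ENNReal.toReal_ofReal (by positivity),
      weightedCoord, partMean_ofReal_mul hkm]
    simp only [F, partMean, map_smul, smul_eq_mul, Complex.I_mul_re, abs_neg]
    ring
  have hF_nonneg (z : EllP p) : 0 ≤ F z := Real.rpow_nonneg (abs_nonneg _) α
  have hint : Integrable F (controlMeasure p α k₀ ω) := by
    refine integrable_sum_measure (fun m =>
      ((hdirac _).add_measure (hdirac _)).smul_measure ENNReal.ofReal_ne_top) ?_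
    simp only [Real.norm_of_nonneg (hF_nonneg _), hatom]
    exact summable_partMean_weightedCoord hα hk₀ hω hk u
  exact (hasSum_integral_measure hint).tsum_eq.symm.trans (tsum_congr hatom)

theorem charExponent_controlMeasure_adj (hα : 0 ≤ α) (hk₀ : 0 ≤ k₀) (hω : ∀ n, 0 < ω n)
    (hk : Summable fun n : ℤ => kSeq k₀ ω n ^ α) {T : EllP p →L[ℂ] EllP p}
    (hT : IsWeightedForwardShift ω T) (u : EllP p →L[ℂ] ℂ) :
    charExponent α (controlMeasure p α k₀ ω) (adj T u) =
      charExponent α (controlMeasure p α k₀ ω) u := by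
  simp only [charExponent_controlMeasure hα hk₀ hω hk,
    weightedCoord_adj (fun n => (hω n).ne') hT]
  exact (Equiv.addRight (1 : ℤ)).tsum_eq fun m => partMean α (weightedCoord k₀ ω u m)

theorem abs_codifference_controlMeasure_le (hα : 0 ≤ α) (hα2 : α ≤ 2) (hk₀ : 0 ≤ k₀)
    (hω : ∀ n, 0 < ω n) (hk : Summable fun n : ℤ => kSeq k₀ ω n ^ α) (u v : EllP p →L[ℂ] ℂ)
    {B : ℤ → ℝ} {S : ℝ} (hB : HasSum B S)
    (hle : ∀ m, ‖weightedCoord k₀ ω u m‖ ^ (α / 2) * ‖weightedCoord k₀ ω v m‖ ^ (α / 2) ≤ B m) :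
    |codifference α (controlMeasure p α k₀ ω) u v| ≤ 2 * S := by
  have hsum (w : EllP p →L[ℂ] ℂ) : HasSum (fun m => partMean α (weightedCoord k₀ ω w m))
      (charExponent α (controlMeasure p α k₀ ω) w) := by
    rw [charExponent_controlMeasure hα hk₀ hω hk]
    exact (summable_partMean_weightedCoord hα hk₀ hω hk w).hasSum
  rw [codifference, ← (((hsum (u + v)).sub (hsum u)).sub (hsum v)).tsum_eq, ← Real.norm_eq_abs]
  refine tsum_of_norm_bounded (hB.mul_left 2) fun m => ?_
  rw [weightedCoord_add]
  exact (abs_partMean_add_sub_sub_le hα hα2 _ _).trans (by gcongr; exact hle m)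

theorem abs_codifference_adj_iterate_le (hα : 0 ≤ α) (hα2 : α ≤ 2) (hk₀ : 0 ≤ k₀)
    (hω : ∀ n, 0 < ω n) (hk : Summable fun n : ℤ => kSeq k₀ ω n ^ α) {T : EllP p →L[ℂ] EllP p}
    (hT : IsWeightedForwardShift ω T) {C S ρ : ℝ} (hρ : 0 < ρ)
    (hle : ∀ i, kSeq k₀ ω i ^ (α / 2) ≤ C * ρ ^ i)
    (hsum : HasSum (fun i : ℤ => ρ ^ i * kSeq k₀ ω i ^ (α / 2)) S) (x y : EllP p →L[ℂ] ℂ)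
    (j l : ℕ) :
    |codifference α (controlMeasure p α k₀ ω) ((adj T)^[j] x) ((adj T)^[l] y)| ≤
      2 * (C * S * ‖x‖ ^ (α / 2) * ‖y‖ ^ (α / 2)) * ρ ^ ((l : ℤ) - j) := by
  set A := C * ‖x‖ ^ (α / 2) * ‖y‖ ^ (α / 2) * ρ ^ ((l : ℤ) - j)
  have hshift : HasSum (fun m : ℤ => A * (ρ ^ (m + j) * kSeq k₀ ω (m + j) ^ (α / 2))) (A * S) :=
    ((Equiv.addRight (j : ℤ)).hasSum_iff.2 hsum).mul_left A
  refine (abs_codifference_controlMeasure_le hα hα2 hk₀ hω hk _ _ hshift fun m => ?_).trans_eq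
    (by ring)
  have hω' : ∀ n, ω n ≠ 0 := fun n => (hω n).ne'
  have hkj := Real.rpow_nonneg (kSeq_nonneg hk₀ hω (m + j)) (α / 2)
  have hpow : ρ ^ (m + l) = ρ ^ (m + j) * ρ ^ ((l : ℤ) - j) := by
    rw [← zpow_add₀ hρ.ne']
    ring_nf
  rw [weightedCoord_adj_iterate hω' hT, weightedCoord_adj_iterate hω' hT]
  calc ‖weightedCoord k₀ ω x (m + j)‖ ^ (α / 2) * ‖weightedCoord k₀ ω y (m + l)‖ ^ (α / 2)
      ≤ kSeq k₀ ω (m + j) ^ (α / 2) * ‖x‖ ^ (α / 2) *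
          (kSeq k₀ ω (m + l) ^ (α / 2) * ‖y‖ ^ (α / 2)) := by
        gcongr <;> exact norm_weightedCoord_rpow_le hk₀ hω (by linarith) _ _
    _ ≤ kSeq k₀ ω (m + j) ^ (α / 2) * ‖x‖ ^ (α / 2) * (C * ρ ^ (m + l) * ‖y‖ ^ (α / 2)) := by
        gcongr
        exact hle _
    _ = A * (ρ ^ (m + j) * kSeq k₀ ω (m + j) ^ (α / 2)) := by rw [hpow]; ring

theorem exists_norm_corr_expSeries_re_le (hα : 0 < α) (hα2 : α ≤ 2) (hk₀ : 0 ≤ k₀)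
    (hω : ∀ n, 0 < ω n) {β r : ℝ} (hβr : β < r) (hr0 : 0 < r) (hr1 : r < 1)
    (hleft : ∀ᶠ l in atBot, 1 / ω l ≤ β) (hright : ∀ᶠ l in atTop, ω l ≤ r)
    {μ : Measure (EllP p)} (hμ : IsStableWithControl α (controlMeasure p α k₀ ω) μ)
    {T : EllP p →L[ℂ] EllP p} (hT : IsWeightedForwardShift ω T) {a b : ℕ → ℂ}
    (ha : Summable fun j => ‖a j‖) (haT : Summable fun j : ℕ => ‖a j‖ * r ^ (-(α * j / 2)))
    (hb : Summable fun l => ‖b l‖) (x y : EllP p →L[ℂ] ℂ) :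
    ∃ C, 0 < C ∧ ∀ n : ℕ,
      ‖corr μ T (expSeries Complex.re T a x) (expSeries Complex.re T b y) n‖ ≤
        C * r ^ (α * n / 2) := by
  have hk := summable_kSeq_rpow hk₀ hω hα hβr hr1 hleft hright
  obtain ⟨C, hle, S, hsum⟩ :=
    exists_kSeq_rpow_le_and_summable hk₀ hω (half_pos hα) hβr hr1 hleft hright
  have hpow (n : ℕ) : (r ^ (α / 2)) ^ n = r ^ (α * n / 2) := by
    rw [← Real.rpow_mul_natCast hr0.le, div_mul_eq_mul_div]
  have hdecay := abs_codifference_adj_iterate_le hα.le hα2 hk₀ hω hk hT (by positivity) hle hsum x y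
  simp only [Real.rpow_neg hr0.le, ← hpow] at haT
  obtain ⟨M, hM⟩ : ∃ M, ∀ n : ℕ,
      ‖corr μ T (expSeries Complex.re T a x) (expSeries Complex.re T b y) n‖ ≤
        M * r ^ (α * n / 2) :=
    ⟨_, fun n => (hpow n ▸ hμ.norm_corr_expSeries_le
      (charExponent_controlMeasure_adj hα.le hk₀ hω hk hT) (by positivity)
      (Real.rpow_le_one hr0.le hr1.le (half_pos hα).le) hdecay ha haT hb n :)⟩
  exact ⟨max M 1, by positivity, fun n => (hM n).trans (by gcongr; exact le_max_left M 1)⟩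

end Shift

section Rates

theorem exists_linearMap_of_mem_partFunctions {φ : ℂ → ℝ} (hφ : φ ∈ partFunctions) :
    ∃ L : ℂ →ₗ[ℝ] ℝ, φ = L := by
  rcases hφ with rfl | rfl | rfl | rfl
  exacts [⟨Complex.reLm, rfl⟩, ⟨-Complex.reLm, rfl⟩, ⟨Complex.imLm, rfl⟩, ⟨-Complex.imLm, rfl⟩]

theorem max_rpow_mem_Ioo {s t α p : ℝ} (hs0 : 0 < s) (hs1 : s < 1) (ht1 : t < 1) (hp : 0 < p)
    (hαp : α < p) (hpα : p < 2 * α) : max (s ^ (2 * α / p - 1)) t ∈ Set.Ioo s 1 := by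
  have hθ0 : 0 < 2 * α / p - 1 := sub_pos.2 ((one_lt_div hp).2 hpα)
  have hθ1 : 2 * α / p - 1 < 1 := by
    rw [sub_lt_iff_lt_add, div_lt_iff₀ hp]
    linarith
  exact ⟨lt_max_of_lt_left (Real.self_lt_rpow_of_lt_one hs0 hs1 hθ1),
    max_lt (Real.rpow_lt_one hs0.le hs1 hθ0) ht1⟩

theorem summable_mul_rpow_neg {c : ℕ → ℝ} (hc : ∀ j, 0 ≤ c j) {α p r t : ℝ} (hα : 0 ≤ α)
    (hαp : α ≤ p) (hr0 : 0 < r) (hr1 : r ≤ 1) (hrt : r⁻¹ ≤ t)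
    (h : Summable fun j : ℕ => c j * t ^ (j * p / 2)) :
    Summable fun j : ℕ => c j * r ^ (-(α * j / 2)) := by
  refine .of_nonneg_of_le (fun j => mul_nonneg (hc j) (by positivity)) (fun j => ?_) h
  have ht : 1 ≤ t := ((one_le_inv₀ hr0).2 hr1).trans hrt
  refine mul_le_mul_of_nonneg_left ?_ (hc j)
  calc r ^ (-(α * j / 2)) = r⁻¹ ^ (j * α / 2) := by
        rw [Real.rpow_neg hr0.le, Real.inv_rpow hr0.le, mul_comm α]
    _ ≤ t ^ (j * α / 2) := by gcongr
    _ ≤ t ^ (j * p / 2) := by gcongr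

theorem summable_of_summable_mul_rpow_neg {c : ℕ → ℝ} (hc : ∀ j, 0 ≤ c j) {α r : ℝ} (hα : 0 ≤ α)
    (hr0 : 0 < r) (hr1 : r ≤ 1) (h : Summable fun j : ℕ => c j * r ^ (-(α * j / 2))) :
    Summable c :=
  .of_nonneg_of_le hc (fun j => le_mul_of_one_le_right (hc j)
    (Real.one_le_rpow_of_pos_of_le_one_of_nonpos hr0 hr1
      (neg_nonpos.2 (by positivity)))) h

end Rates

end StableShift

open Filter StableShift in
theorem corollary5p3_general {α p β r : ℝ} (hα : 0 < α) (hα2 : α ≤ 2)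
    [Fact (1 ≤ ENNReal.ofReal p)] [MeasurableSpace (EllP p)] [BorelSpace (EllP p)]
    {ω : ℤ → ℝ} (hω : ∀ n, 0 < ω n) {k₀ : ℝ} (hk₀ : 0 ≤ k₀) {μ : Measure (EllP p)}
    (hμ : IsStableWithControl α (controlMeasure p α k₀ ω) μ) {T : EllP p →L[ℂ] EllP p}
    (hT : IsWeightedForwardShift ω T) (hβr : β < r) (hr1 : r < 1)
    (hleft : ∀ᶠ l in atBot, 1 / ω l ≤ β) (hright : ∀ᶠ l in atTop, ω l ≤ r)
    (φ ψ : ℂ →ₗ[ℝ] ℝ) {a b : ℕ → ℂ}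
    (haT : Summable fun j : ℕ => ‖a j‖ * r ^ (-(α * j / 2))) (hb : Summable fun l => ‖b l‖)
    (x y : EllP p →L[ℂ] ℂ) :
    (∀ z, Summable fun j => ‖expTerm φ T a x z j‖) ∧
    (∀ z, Summable fun l => ‖expTerm ψ T b y z l‖) ∧
    MemLp (expSeries φ T a x) 2 μ ∧
    MemLp (expSeries ψ T b y) 2 μ ∧
    (∀ n : ℕ, Integrable (fun z => expSeries φ T a x z * expSeries ψ T b y ((T ^ n) z)) μ) ∧
    ∃ C, 0 < C ∧ ∀ n : ℕ,
      ‖corr μ T (expSeries φ T a x) (expSeries ψ T b y) n‖ ≤ C * r ^ (α * n / 2) := by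
  have := hμ.isProbabilityMeasure
  have hr0 : 0 < r := by
    obtain ⟨l, hl⟩ := hright.exists
    exact (hω l).trans_le hl
  have ha := summable_of_summable_mul_rpow_neg (fun j => norm_nonneg (a j)) hα.le hr0 hr1.le haT
  have hφ := φ.continuous_of_finiteDimensional
  have hψ := ψ.continuous_of_finiteDimensional
  refine ⟨summable_norm_expTerm φ T ha x, summable_norm_expTerm ψ T hb y,
    memLp_expSeries hφ T ha x 2, memLp_expSeries hψ T hb y 2,
    integrable_expSeries_mul hφ hψ T ha hb x y, ?_⟩
  rw [expSeries_linearMap φ, expSeries_linearMap ψ]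
  exact exists_norm_corr_expSeries_re_le hα hα2 hk₀ hω hβr hr0 hr1 hleft hright hμ hT ha haT hb _ _

theorem corollary5p3
    (α p : ℝ) (hα : 1 / 2 < α) (hα2 : α < 2) (hα1 : α ≠ 1)
    [Fact (1 ≤ ENNReal.ofReal p)] (hp2 : p ≤ 2) (hαp : α < p) (hpα : p < 2 * α)
    [MeasurableSpace (StableShift.EllP p)] [BorelSpace (StableShift.EllP p)]
    -- the weights and the control measure
    (ω : ℤ → ℝ) (hω : ∀ n, 0 < ω n) (k₀ : ℝ) (hk₀ : 0 ≤ k₀)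
    (hk : Summable fun n : ℤ => StableShift.kSeq k₀ ω n ^ α)
    (μ : MeasureTheory.Measure (StableShift.EllP p))
    (hμ : StableShift.IsStableWithControl α (StableShift.controlMeasure p α k₀ ω) μ)
    (T : StableShift.EllP p →L[ℂ] StableShift.EllP p)
    (hT : StableShift.IsWeightedForwardShift ω T)
    -- `η₋ = sup_{l ≤ -q₋} 1/ω_l < 1` and `η₊ = sup_{l ≥ q₊} ω_l < 1`
    (qm qp : ℤ) (hqm : 0 ≤ qm) (hqp : 1 ≤ qp) (ηm ηp : ℝ)
    (hηm : IsLUB ((fun l : ℤ => 1 / ω l) '' Set.Iic (-qm)) ηm) (hηm1 : ηm < 1)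
    (hηp : IsLUB (ω '' Set.Ici qp) ηp) (hηp1 : ηp < 1)
    (hne : ηp ^ (p / 2) ≠ ηm ^ (α - p / 2))
    -- the pair `(φ, ψ)`, the coefficients and the functionals
    (φ ψ : ℂ → ℝ) (hφ : φ ∈ StableShift.partFunctions) (hψ : ψ ∈ StableShift.partFunctions)
    (hφψ : φ ≠ ψ)
    (a b : ℕ → ℂ) (ha : Summable fun j => ‖a j‖) (hb : Summable fun l => ‖b l‖)
    (haT : Summable fun j : ℕ => ‖a j‖ * ‖T‖ ^ ((j : ℝ) * p / 2))
    (hbT : Summable fun l : ℕ => ‖b l‖ * ‖T‖ ^ ((l : ℝ) * p / 2))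
    (x y : StableShift.EllP p →L[ℂ] ℂ) :
    (∀ z, Summable fun j => ‖StableShift.expTerm φ T a x z j‖) ∧
    (∀ z, Summable fun l => ‖StableShift.expTerm ψ T b y z l‖) ∧
    MeasureTheory.MemLp (StableShift.expSeries φ T a x) 2 μ ∧
    MeasureTheory.MemLp (StableShift.expSeries ψ T b y) 2 μ ∧
    (∀ n : ℕ, MeasureTheory.Integrable
      (fun z => StableShift.expSeries φ T a x z * StableShift.expSeries ψ T b y ((T ^ n) z)) μ) ∧
    ∃ C : ℝ, 0 < C ∧ ∀ n : ℕ,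
      ‖StableShift.corr μ T (StableShift.expSeries φ T a x) (StableShift.expSeries ψ T b y) n‖
        ≤ C * max (ηm ^ (2 * α / p - 1)) ηp ^ (α * n / 2) := by
  have hωm (l : ℤ) (hl : l ≤ -qm) : 1 / ω l ≤ ηm := hηm.1 ⟨l, hl, rfl⟩
  have hηm0 : 0 < ηm := (one_div_pos.2 (hω _)).trans_le (hωm _ le_rfl)
  obtain ⟨hηmr, hr1⟩ :=
    StableShift.max_rpow_mem_Ioo hηm0 hηm1 hηp1 (by linarith) hαp hpα
  have hr0 := hηm0.trans hηmr
  have hrT := hT.inv_le_opNorm hr0 (hω (-qm)) ((hωm _ le_rfl).trans hηmr.le)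
  obtain ⟨φ, rfl⟩ := StableShift.exists_linearMap_of_mem_partFunctions hφ
  obtain ⟨ψ, rfl⟩ := StableShift.exists_linearMap_of_mem_partFunctions hψ
  exact corollary5p3_general (by linarith) hα2.le hω hk₀ hμ hT hηmr hr1
    ((Filter.eventually_le_atBot (-qm)).mono hωm)
    ((Filter.eventually_ge_atTop qp).mono fun l hl => le_max_of_le_right (hηp.1 ⟨l, hl, rfl⟩))
    φ ψ (StableShift.summable_mul_rpow_neg (fun _ => norm_nonneg _) (by linarith) hαp.le hr0 hr1.le
      hrT haT) hb x y
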